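/- Let $\mathbb{K}$ be a field, let $G$ be a finite simple graph with vertex set $\{v_1,\dots,v_n\}$, and let $I(G)\subseteq S=\mathbb{K}[x_1,\dots,x_n]$ be its edge ideal, that is, the ideal generated by the monomials $x_ix_j$ with $\{v_i,v_j\}$ an edge of $G$. For a nonzero monomial ideal $J\subseteq S$, a Stanley decomposition of $J$ is a decomposition $\mathcal{D}: J=\bigoplus_{i=1}^r u_i\mathbb{K}[Z_i]$ as a finite direct sum of $\mathbb{K}$-subspaces, where $u_i\in J$ is $\mathbb{Z}^n$-homogeneous (a scalar multiple of a monomial), $Z_i\subseteq\{x_1,\dots,x_n\}$, and $u_i\mathbb{K}[Z_i]$ is a free $\mathbb{K}[Z_i]$-module with basis $u_i$. Put ${\rm sdepth}(\mathcal{D})=\min_i |Z_i|$, and let the Stanley depth ${\rm sdepth}(J)$ be the maximum of ${\rm sdepth}(\mathcal{D})$ over all Stanley decompositions $\mathcal{D}$ of $J$. Let $p$ be the number of connected components of $G$ that are bipartite (an isolated vertex counts as a bipartite component), and suppose that at least one of the connected components of $G$ is a tree with at least one edge. Then for every integer $k\geq 1$, $${\rm sdepth}(I(G)^k)\geq p+1.$$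 -/

import Mathlib

/-- The edge ideal `I(G)` of a graph `G` on the vertex set `V`, in the polynomial ring over `K` with
one variable for each vertex: it is generated by the products `x_i x_j`, `{i, j}` an edge of `G`. -/
noncomputable def edgeIdeal (K : Type*) [Field K] {V : Type*} (G : SimpleGraph V) :
    Ideal (MvPolynomial V K) :=
  Ideal.span {f | ∃ i j : V, G.Adj i j ∧ f = MvPolynomial.X i * MvPolynomial.X j}

/-- The number of connected components of `G` that are bipartite graphs. (An isolated vertex is a
bipartite component.) -/
noncomputable def numBipartiteComponents {V : Type*} (G : SimpleGraph V) : ℕ :=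
  Nat.card {C : G.ConnectedComponent // C.toSimpleGraph.IsBipartite}

/-- An element of the polynomial ring is homogeneous for the fine (that is, `ℤⁿ`-) grading if it is a
scalar multiple of a monomial. The `ℤⁿ`-homogeneous elements of a monomial ideal are its elements of
this form. -/
def IsMultihomogeneous {K : Type*} [Field K] {V : Type*} (u : MvPolynomial V K) : Prop :=
  ∃ (a : V →₀ ℕ) (c : K), u = MvPolynomial.monomial a c

/-- The `K`-subspace `u K[Z] = {u v | v ∈ K[Z]}`, where `K[Z]` is the subalgebra of the polynomials
in the variables belonging to `Z`. -/
noncomputable def stanleySpace {K : Type*} [Field K] {V : Type*} (u : MvPolynomial V K)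
    (Z : Finset V) : Submodule K (MvPolynomial V K) :=
  (MvPolynomial.supported K (Z : Set V)).toSubmodule.map (LinearMap.mulLeft K u)

/-- A Stanley decomposition of a (monomial) ideal `J`: a finite family of Stanley spaces
`u_i K[Z_i]`, with `u_i` an `ℤⁿ`-homogeneous element, whose internal direct sum, as a `K`-vector space,
is `J`. -/
structure StanleyDecomposition {K : Type*} [Field K] {V : Type*}
    (J : Ideal (MvPolynomial V K)) where
  /-- the number of Stanley spaces -/
  r : ℕ
  u : Fin r → MvPolynomial V K
  Z : Fin r → Finset V
  homogeneous : ∀ i, IsMultihomogeneous (u i)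
  /-- `u_i K[Z_i]` is a free `K[Z_i]`-module, with basis `u_i` -/
  free : ∀ i, ∀ v ∈ MvPolynomial.supported K (Z i : Set V), u i * v = 0 → v = 0
  independent : iSupIndep fun i => stanleySpace (u i) (Z i)
  iSup_eq : ⨆ i, stanleySpace (u i) (Z i) = J.restrictScalars K

/-- The Stanley depth of a decomposition: the smallest dimension `|Z_i|` of its Stanley spaces
(`⊤` for the empty decomposition, which only the zero ideal has). -/
noncomputable def StanleyDecomposition.sdepth {K : Type*} [Field K] {V : Type*}
    {J : Ideal (MvPolynomial V K)} (D : StanleyDecomposition J) : ℕ∞ :=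
  ⨅ i, ((D.Z i).card : ℕ∞)

/-- The Stanley depth of a monomial ideal: the largest Stanley depth of its Stanley decompositions.
For a nonzero ideal in finitely many variables the values `D.sdepth` are bounded by the number of
variables, so the supremum is a maximum. -/
noncomputable def sdepth {K : Type*} [Field K] {V : Type*} (J : Ideal (MvPolynomial V K)) : ℕ∞ :=
  ⨆ D : StanleyDecomposition J, D.sdepth

/-!
A Stanley decomposition of a monomial ideal is a partition of its set of exponent vectors into
cones, so the theorem is a statement about partitions, with variables taken one component of `G` at
a time. For a graph that is the disjoint union of `G'` and `G''`, a monomial has `I(G)`-adic order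
equal to the sum of its two orders. Sorting the monomials of `I(G)^k` by their order with respect to
`G'` therefore expresses `I(G)^k` through the layers `I(G')^i \ I(G')^(i+1)` and the powers of
`I(G'')`, and depths add.

For `G'` take everything but the tree and let `G''` be the tree. By the weighted form of König's
theorem, a monomial outside `I(H)^(i+1)`, for `H` bipartite, has a vertex cover of weight at most
`i`; a variable off that cover can be raised freely, so each bipartite component contributes `1` to
the depth of the layers. The tree `T` contributes `2`: for a leaf `x` with neighbour `y`, a monomial
of `I(T)^k` misses `x`, or misses `y` (and then `x` is a free variable), or is `x y` times a
monomial of `I(T)^(k-1)`.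
-/

section StanleyPartition

variable {V : Type*}

/-- The exponent vectors of the monomials in the Stanley space `x^a K[Z]`. -/
def stanleyCone (a : V → ℕ) (Z : Finset V) : Set (V → ℕ) :=
  {m | ∀ v, a v ≤ m v ∧ (v ∉ Z → m v = a v)}

variable [DecidableEq V]

/-- `StanleyPartition A d U`: the set `U` of exponent vectors, which only depends on the coordinates
in `A`, is a finite disjoint union of cones that have at least `d` free directions in `A`. This is
Stanley depth at least `d` for the monomial space with exponents `U` in the variables `A`. -/
inductive StanleyPartition (A : Finset V) (d : ℕ) : Set (V → ℕ) → Prop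
  | empty : StanleyPartition A d ∅
  | cone (a : V → ℕ) (Z : Finset V) (ha : ∀ v ∉ A, a v = 0) (hZ : ∀ v ∉ A, v ∈ Z)
      (hd : d ≤ (Z ∩ A).card) : StanleyPartition A d (stanleyCone a Z)
  | union {U W : Set (V → ℕ)} (hU : StanleyPartition A d U) (hW : StanleyPartition A d W)
      (hUW : Disjoint U W) : StanleyPartition A d (U ∪ W)

variable {A B : Finset V} {d e : ℕ} {U W : Set (V → ℕ)}

theorem stanleyCone_inter {a b : V → ℕ} {Z Y : Finset V} (hAB : Disjoint A B)
    (ha : ∀ v ∉ A, a v = 0) (hZ : ∀ v ∉ A, v ∈ Z) (hb : ∀ v ∉ B, b v = 0)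
    (hY : ∀ v ∉ B, v ∈ Y) :
    stanleyCone a Z ∩ stanleyCone b Y = stanleyCone (a + b) (Z ∩ Y) := by
  ext m
  simp only [stanleyCone, Set.mem_inter_iff, Set.mem_ofPred_eq, ← forall_and, Pi.add_apply,
    Finset.mem_inter]
  refine forall_congr' fun v => ?_
  by_cases hv : v ∈ A
  · have hvB := Finset.disjoint_left.1 hAB hv
    simp [hb v hvB, hY v hvB]
  · simp [ha v hv, hZ v hv]

namespace StanleyPartition

theorem mono (h : StanleyPartition A d U) (hed : e ≤ d) : StanleyPartition A e U := by
  induction h with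
  | empty => exact empty
  | cone a Z ha hZ hd => exact cone a Z ha hZ (hed.trans hd)
  | union _ _ h ih₁ ih₂ => exact union ih₁ ih₂ h

theorem congr (h : StanleyPartition A d U) (hUW : ∀ m, m ∈ W ↔ m ∈ U) :
    StanleyPartition A d W := by
  rwa [Set.ext hUW]

theorem of_fibers {ι : Type*} (f : (V → ℕ) → ι) (hf : (f '' U).Finite)
    (h : ∀ m ∈ U, StanleyPartition A d {n ∈ U | f n = f m}) : StanleyPartition A d U := by
  suffices ∀ t : Set ι, t.Finite → t ⊆ f '' U → StanleyPartition A d {n ∈ U | f n ∈ t} from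
    (this _ hf subset_rfl).congr fun m => ⟨fun hm => ⟨hm, m, hm, rfl⟩, And.left⟩
  intro t ht
  induction t, ht using Set.Finite.induction_on with
  | empty => exact fun _ => empty.congr (by simp)
  | @insert i t hi _ ih =>
    rw [Set.insert_subset_iff]
    rintro ⟨⟨m, hm, rfl⟩, ht⟩
    refine (union (h m hm) (ih ht) ?_).congr fun n => ?_
    · exact Set.disjoint_left.2 fun n hn hnt => hi (hn.2 ▸ hnt.2)
    · simp only [Set.mem_insert_iff, Set.mem_ofPred_eq, Set.mem_union, and_or_left]

theorem inter (hU : StanleyPartition A d U) (hW : StanleyPartition B e W) (hAB : Disjoint A B) :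
    StanleyPartition (A ∪ B) (d + e) (U ∩ W) := by
  induction hU with
  | empty => exact empty.congr (by simp)
  | union _ _ h ih₁ ih₂ =>
    rw [Set.union_inter_distrib_right]
    exact union ih₁ ih₂ (h.mono Set.inter_subset_left Set.inter_subset_left)
  | cone a Z ha hZ hd =>
    induction hW with
    | empty => exact empty.congr (by simp)
    | union _ _ h ih₁ ih₂ =>
      rw [Set.inter_union_distrib_left]
      exact union ih₁ ih₂ (h.mono Set.inter_subset_right Set.inter_subset_right)
    | cone b Y hb hY he =>
      rw [stanleyCone_inter hAB ha hZ hb hY]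
      have hsub : (Z ∩ A) ∪ (Y ∩ B) ⊆ Z ∩ Y ∩ (A ∪ B) := by
        intro v hv
        have : v ∈ A → v ∉ B := fun hvA => Finset.disjoint_left.1 hAB hvA
        grind
      refine cone _ _ (fun v hv => ?_) (fun v hv => ?_) ?_
      · simp_all
      · simp_all
      · calc d + e ≤ (Z ∩ A).card + (Y ∩ B).card := add_le_add hd he
          _ = ((Z ∩ A) ∪ (Y ∩ B)).card := (Finset.card_union_of_disjoint
            (hAB.mono Finset.inter_subset_right Finset.inter_subset_right)).symm
          _ ≤ _ := Finset.card_le_card hsub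

theorem inter_erase {v : V} (hv : v ∈ A) (hU : StanleyPartition {v} d U)
    (hW : StanleyPartition (A.erase v) e W) : StanleyPartition A (d + e) (U ∩ W) := by
  have h := hU.inter hW (by simp)
  rwa [← Finset.insert_eq, Finset.insert_erase hv] at h

theorem image_add_right {a : V → ℕ} (ha : ∀ v ∉ A, a v = 0) (h : StanleyPartition A d U) :
    StanleyPartition A d ((· + a) '' U) := by
  induction h with
  | empty => exact empty.congr (by simp)
  | union _ _ h ih₁ ih₂ =>
    rw [Set.image_union]
    exact union ih₁ ih₂ ((Set.disjoint_image_iff (add_left_injective a)).2 h)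
  | cone b Z hb hZ hd =>
    refine (cone (b + a) Z (fun v hv => ?_) hZ hd).congr fun m => ?_
    · simp [ha v hv, hb v hv]
    · constructor
      · rintro ⟨n, hn, rfl⟩ v
        simpa using hn v
      · intro hm
        refine ⟨m - a, fun v => ?_, funext fun v => ?_⟩ <;> have := hm v <;>
          simp only [Pi.add_apply, Pi.sub_apply] at this ⊢ <;> grind

variable [Finite V]

theorem univ (A : Finset V) : StanleyPartition A A.card (Set.univ : Set (V → ℕ)) := by
  have := Fintype.ofFinite V
  exact (cone 0 Finset.univ (by simp) (by simp) (by simp)).congr (by simp [stanleyCone])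

theorem setOf_eq (v : V) (c : ℕ) : StanleyPartition {v} 0 {m | m v = c} := by
  have := Fintype.ofFinite V
  refine (cone (Pi.single v c) (Finset.univ.erase v) ?_ ?_ (Nat.zero_le _)).congr fun m => ?_
  · simp +contextual
  · simp
  · refine ⟨?_, fun h => by simpa using (h v).2⟩
    rintro rfl w
    rcases eq_or_ne w v with rfl | hw <;> simp [*]

theorem setOf_ge (v : V) (c : ℕ) : StanleyPartition {v} 1 {m | c ≤ m v} := by
  have := Fintype.ofFinite V
  refine (cone (Pi.single v c) Finset.univ ?_ (by simp) (by simp)).congr fun m => ?_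
  · simp +contextual
  · refine ⟨fun hm w => ?_, fun h => by simpa using (h v).1⟩
    rcases eq_or_ne w v with rfl | hw <;> simp_all

end StanleyPartition

end StanleyPartition

section DependsOnTruncation

/-- Membership in `U` only depends on the coordinates in `A`, truncated at `N`. All sets of
exponents occurring for powers of monomial ideals have this property, which makes them finite
objects. -/
def DependsOnTruncation {V : Type*} (A : Finset V) (N : ℕ) (U : Set (V → ℕ)) : Prop :=
  ∀ ⦃m n : V → ℕ⦄, (∀ v ∈ A, min (m v) N = min (n v) N) → (m ∈ U ↔ n ∈ U)

namespace DependsOnTruncation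

variable {V : Type*} {A B : Finset V} {N M : ℕ} {U W : Set (V → ℕ)}

theorem compl (h : DependsOnTruncation A N U) : DependsOnTruncation A N Uᶜ :=
  fun _ _ hmn => not_congr (h hmn)

theorem inter (hU : DependsOnTruncation A N U) (hW : DependsOnTruncation A N W) :
    DependsOnTruncation A N (U ∩ W) :=
  fun _ _ hmn => and_congr (hU hmn) (hW hmn)

theorem iInter {ι : Sort*} {U : ι → Set (V → ℕ)} (h : ∀ i, DependsOnTruncation A N (U i)) :
    DependsOnTruncation A N (⋂ i, U i) := by
  intro m n hmn
  simp only [Set.mem_iInter]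
  exact forall_congr' fun i => h i hmn

theorem mono (h : DependsOnTruncation A N U) (hAB : A ⊆ B) (hNM : N ≤ M) :
    DependsOnTruncation B M U := by
  refine fun m n hmn => h fun v hv => ?_
  have := hmn v (hAB hv)
  omega

variable [DecidableEq V]

theorem setOf_update (h : DependsOnTruncation A N U) (v : V) (p : Set ℕ → Prop) :
    DependsOnTruncation (A.erase v) N {m | p {c | Function.update m v c ∈ U}} := by
  intro m n hmn
  have hupdate : ∀ c, Function.update m v c ∈ U ↔ Function.update n v c ∈ U := by
    refine fun c => h fun w hw => ?_
    rcases eq_or_ne w v with rfl | hwv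
    · simp
    · simpa [hwv] using hmn w (Finset.mem_erase.2 ⟨hwv, hw⟩)
  simp only [Set.mem_ofPred_eq, hupdate]

variable [Finite V]

theorem stanleyPartition (h : DependsOnTruncation A N U) : StanleyPartition A 0 U := by
  have := Fintype.ofFinite V
  let trunc : (V → ℕ) → V → ℕ := fun m v => if v ∈ A then min (m v) N else 0
  refine .of_fibers trunc ((Set.finite_Iic fun _ => N).subset ?_) fun m hm => ?_
  · rintro _ ⟨m, -, rfl⟩ v
    simp only [trunc]
    split_ifs <;> simp
  refine (StanleyPartition.cone (trunc m) {v | v ∈ A → N ≤ m v} ?_ ?_ (Nat.zero_le _)).congr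
    fun n => ?_
  · exact fun v hv => if_neg hv
  · simp +contextual
  · simp only [stanleyCone, Set.mem_ofPred_eq, Finset.mem_filter_univ, trunc, funext_iff]
    constructor
    · rintro ⟨-, hn⟩ v
      have := hn v
      split_ifs at * <;> grind
    · intro hn
      have htrunc : ∀ v ∈ A, min (n v) N = min (m v) N := by
        intro v hv
        have := hn v
        simp only [hv, if_true, true_imp_iff] at this
        omega
      refine ⟨(h htrunc).2 hm, fun v => ?_⟩
      split_ifs with hv
      exacts [htrunc v hv, rfl]

theorem stanleyPartition_one (h : DependsOnTruncation A N U) {v : V} (hv : v ∈ A)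
    (hU : ∀ m ∈ U, ∀ c ≥ m v, Function.update m v c ∈ U) : StanleyPartition A 1 U := by
  let entry : (V → ℕ) → ℕ := fun m => sInf {c | Function.update m v c ∈ U}
  have hentry : ∀ m ∈ U, IsLeast {c | Function.update m v c ∈ U} (entry m) := fun m hm =>
    ⟨Nat.sInf_mem ⟨m v, by simpa using hm⟩, fun _ hc => Nat.sInf_le hc⟩
  refine .of_fibers entry ((Set.finite_Iic N).subset ?_) fun m _ => ?_
  · rintro _ ⟨m, hm, rfl⟩
    refine (hentry m hm).2 ((h fun w _ => ?_).1 (hU m hm (max (m v) N) (le_max_left _ _)))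
    rcases eq_or_ne w v with rfl | hw <;> simp [*]
  refine ((StanleyPartition.setOf_ge v (entry m)).inter_erase hv
    (h.setOf_update v fun S => IsLeast S (entry m)).stanleyPartition).congr fun n => ?_
  constructor
  · rintro ⟨hn, hnm⟩
    have hleast := hentry n hn
    rw [hnm] at hleast
    exact ⟨hleast.2 (by simpa using hn), hleast⟩
  · rintro ⟨hmn, hleast⟩
    exact ⟨by simpa using hU _ hleast.1 (n v) (by simpa using hmn), hleast.csInf_eq⟩

theorem stanleyPartition_diff {P Q : Set (V → ℕ)} (hP : DependsOnTruncation A N P)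
    (hQ : DependsOnTruncation A N Q) (hPu : IsUpperSet P) (hQu : IsUpperSet Q)
    (h : ∀ m ∈ P, m ∉ Q → ∃ v ∈ A, ∀ c, Function.update m v c ∉ Q) :
    StanleyPartition A 1 (P \ Q) := by
  let avoids : V → Set (V → ℕ) := fun v => {m | ∀ c, Function.update m v c ∉ Q}
  have havoids : ∀ v, DependsOnTruncation A N (avoids v) := fun v =>
    (hQ.setOf_update v fun S => ∀ c, c ∉ S).mono (Finset.erase_subset v A) le_rfl
  suffices ∀ S ⊆ A, StanleyPartition A 1 {m ∈ P \ Q | ∃ v ∈ S, m ∈ avoids v} from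
    (this A subset_rfl).congr fun m => ⟨fun hm => ⟨hm, h m hm.1 hm.2⟩, And.left⟩
  intro S
  induction S using Finset.induction_on with
  | empty => exact fun _ => StanleyPartition.empty.congr (by simp)
  | insert v S _ ih =>
    rw [Finset.insert_subset_iff]
    rintro ⟨hvA, hSA⟩
    have hfirst : StanleyPartition A 1
        ((P ∩ Qᶜ) ∩ (avoids v ∩ ⋂ w, ⋂ _ : w ∈ S, (avoids w)ᶜ)) := by
      refine ((hP.inter hQ.compl).inter ((havoids v).inter
        (iInter fun w => iInter fun _ => (havoids w).compl))).stanleyPartition_one hvA ?_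
      rintro m ⟨⟨hmP, -⟩, hmv, hmS⟩ c hc
      have hle : m ≤ Function.update m v c := le_update_self_iff.2 hc
      refine ⟨⟨hPu hle hmP, hmv c⟩, fun c' => by simpa using hmv c', ?_⟩
      simp only [Set.mem_iInter] at hmS ⊢
      exact fun w hw hcw => hmS w hw fun c' hc' =>
        hcw c' (hQu (update_le_update_iff.2 ⟨le_rfl, fun u _ => hle u⟩) hc')
    refine (hfirst.union (ih hSA) (Set.disjoint_left.2 ?_)).congr fun m => ?_
    · rintro m ⟨-, -, hmS⟩ ⟨-, w, hw, hmw⟩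
      simp only [Set.mem_iInter] at hmS
      exact hmS w hw hmw
    · simp only [Set.mem_union, Set.mem_inter_iff, Set.mem_iInter, Set.mem_compl_iff,
        Set.mem_ofPred_eq, Set.mem_sdiff, Finset.mem_insert, exists_eq_or_imp]
      grind

end DependsOnTruncation

end DependsOnTruncation

section EdgePow

variable {V : Type*} [DecidableEq V]

/-- The exponent vectors of the monomials in the `k`-th power of the edge ideal of `G`. -/
def edgePow (G : SimpleGraph V) : ℕ → Set (V → ℕ)
  | 0 => Set.univ
  | k + 1 => {m | ∃ i j, G.Adj i j ∧ ∃ n ∈ edgePow G k, m = n + Pi.single i 1 + Pi.single j 1}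

variable {G H : SimpleGraph V} {A : Finset V} {k l : ℕ} {m n : V → ℕ} {i j x y : V}

namespace edgePow

theorem add_edge (hm : m ∈ edgePow G k) (h : G.Adj i j) :
    m + Pi.single i 1 + Pi.single j 1 ∈ edgePow G (k + 1) :=
  ⟨i, j, h, m, hm, rfl⟩

theorem of_sub_edge (h : G.Adj i j) (hi : 1 ≤ m i) (hj : 1 ≤ m j)
    (hm : m - Pi.single i 1 - Pi.single j 1 ∈ edgePow G k) : m ∈ edgePow G (k + 1) := by
  refine ⟨i, j, h, _, hm, funext fun v => ?_⟩
  have := h.ne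
  simp only [Pi.add_apply, Pi.sub_apply, Pi.single_apply]
  grind

theorem of_le_on_support (hmn : ∀ v ∈ G.support, m v ≤ n v) (hm : m ∈ edgePow G k) :
    n ∈ edgePow G k := by
  induction k generalizing m n with
  | zero => trivial
  | succ k ih =>
    obtain ⟨i, j, hij, m, hm, rfl⟩ := hm
    have hi := hmn i ⟨j, hij⟩
    have hj := hmn j ⟨i, hij.symm⟩
    simp only [Pi.add_apply, Pi.single_eq_same] at hi hj
    refine of_sub_edge hij (by omega) (by omega) (ih (fun v hv => ?_) hm)
    have := hmn v hv
    simp only [Pi.add_apply, Pi.sub_apply] at this ⊢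
    omega

theorem congr_on_support (hmn : ∀ v ∈ G.support, m v = n v) :
    m ∈ edgePow G k ↔ n ∈ edgePow G k :=
  ⟨of_le_on_support fun v hv => (hmn v hv).le, of_le_on_support fun v hv => (hmn v hv).ge⟩

theorem isUpperSet : IsUpperSet (edgePow G k) :=
  fun _ _ hmn => of_le_on_support fun v _ => hmn v

theorem antitone : Antitone (edgePow G) := by
  refine antitone_nat_of_succ_le fun k m hm => ?_
  obtain ⟨i, j, -, n, hn, rfl⟩ := hm
  rw [add_assoc]
  exact isUpperSet le_self_add hn

theorem mono_graph (hGH : G ≤ H) : edgePow G k ⊆ edgePow H k := by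
  induction k with
  | zero => exact subset_rfl
  | succ k ih =>
    rintro _ ⟨i, j, hij, n, hn, rfl⟩
    exact add_edge (ih hn) (hGH hij)

theorem min_mem (hm : m ∈ edgePow G k) : (fun v => min (m v) k) ∈ edgePow G k := by
  induction k generalizing m with
  | zero => trivial
  | succ k ih =>
    obtain ⟨i, j, hij, n, hn, rfl⟩ := hm
    refine isUpperSet (fun v => ?_) (add_edge (ih hn) hij)
    have := hij.ne
    simp only [Pi.add_apply, Pi.single_apply]
    grind

theorem dependsOnTruncation (hA : G.support ⊆ A) : DependsOnTruncation A k (edgePow G k) := by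
  have himp : ∀ m n : V → ℕ, (∀ v ∈ A, min (m v) k = min (n v) k) →
      m ∈ edgePow G k → n ∈ edgePow G k := fun m n hmn hm =>
    of_le_on_support (fun v hv => (hmn v (hA hv)).trans_le (min_le_left _ _)) (min_mem hm)
  exact fun m n hmn => ⟨himp m n hmn, himp n m fun v hv => (hmn v hv).symm⟩

/-- Either no edge of a factorization contains `x`, or such an edge can be split off. -/
theorem deleteIncidenceSet_or (x : V) (hm : m ∈ edgePow G k) :
    m ∈ edgePow (G.deleteIncidenceSet x) k ∨ ∃ y, G.Adj x y ∧ ∃ l, k = l + 1 ∧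
      ∃ n ∈ edgePow G l, m = n + Pi.single x 1 + Pi.single y 1 := by
  induction k generalizing m with
  | zero => exact .inl trivial
  | succ k ih =>
    obtain ⟨i, j, hij, m, hm, rfl⟩ := hm
    by_cases hix : i = x
    · subst hix
      exact .inr ⟨j, hij, k, rfl, m, hm, rfl⟩
    by_cases hjx : j = x
    · subst hjx
      exact .inr ⟨i, hij.symm, k, rfl, m, hm, add_right_comm _ _ _⟩
    rcases ih hm with h | ⟨y, hxy, l, rfl, n, hn, rfl⟩
    · exact .inl (add_edge h (SimpleGraph.deleteIncidenceSet_adj.2 ⟨hij, hix, hjx⟩))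
    · exact .inr ⟨y, hxy, l + 1, rfl, _, add_edge hn hij, by abel⟩

theorem mem_deleteIncidenceSet_of_eq_zero (hx : m x = 0) :
    m ∈ edgePow (G.deleteIncidenceSet x) k ↔ m ∈ edgePow G k := by
  refine ⟨fun hm => mono_graph (G.deleteIncidenceSet_le x) hm,
    fun hm => (deleteIncidenceSet_or x hm).resolve_right ?_⟩
  rintro ⟨y, -, l, -, n, -, rfl⟩
  simp at hx

theorem of_mem_deleteIncidenceSet_add_single
    (hm : m + Pi.single x 1 ∈ edgePow (G.deleteIncidenceSet x) k) : m ∈ edgePow G k := by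
  refine mono_graph (G.deleteIncidenceSet_le x) ((congr_on_support fun v hv => ?_).1 hm)
  have hvx : v ≠ x := (G.support_deleteIncidenceSet_subset x hv).2
  simp [hvx]

theorem of_add_single (hm : m + Pi.single x 1 ∈ edgePow G (k + 1)) : m ∈ edgePow G k := by
  rcases deleteIncidenceSet_or x hm with h | ⟨y, -, l, hl, n, hn, h⟩
  · exact antitone k.le_succ (of_mem_deleteIncidenceSet_add_single h)
  · obtain rfl := Nat.succ_injective hl
    rw [add_right_comm, add_right_cancel_iff] at h
    exact isUpperSet (h ▸ le_self_add) hn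

theorem add_edge_iff_of_leaf (hxy : G.Adj x y) (hleaf : ∀ z, G.Adj x z → z = y) :
    m + Pi.single x 1 + Pi.single y 1 ∈ edgePow G (k + 1) ↔ m ∈ edgePow G k := by
  refine ⟨fun h => ?_, fun h => add_edge h hxy⟩
  rcases deleteIncidenceSet_or x h with h | ⟨z, hxz, l, hl, n, hn, h⟩
  · rw [add_right_comm] at h
    exact of_add_single (of_mem_deleteIncidenceSet_add_single h)
  · obtain rfl := hleaf z hxz
    obtain rfl := Nat.succ_injective hl
    rwa [add_right_cancel (add_right_cancel h)]

/-- The easy half of the weighted form of König's theorem. -/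
theorem le_sum_of_isVertexCover {W : Finset V} (hW : G.IsVertexCover W) (hm : m ∈ edgePow G k) :
    k ≤ ∑ v ∈ W, m v := by
  induction k generalizing m with
  | zero => exact Nat.zero_le _
  | succ k ih =>
    obtain ⟨i, j, hij, n, hn, rfl⟩ := hm
    have := ih hn
    simp only [Pi.add_apply, Finset.sum_add_distrib, Finset.sum_pi_single']
    rcases hW hij with h | h <;> simp only [Finset.mem_coe] at h <;> simp only [h, if_true] <;>
      omega

theorem sup_of_disjoint (hGH : Disjoint G.support H.support) (hG : m ∈ edgePow G k)
    (hH : m ∈ edgePow H l) : m ∈ edgePow (G ⊔ H) (k + l) := by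
  induction l generalizing m with
  | zero => exact mono_graph le_sup_left hG
  | succ l ih =>
    obtain ⟨i, j, hij, n, hn, rfl⟩ := hH
    refine add_edge (ih ((congr_on_support fun v hv => ?_).1 hG) hn) (.inr hij)
    have hvi : v ≠ i := fun h => Set.disjoint_left.1 hGH hv (h ▸ ⟨j, hij⟩)
    have hvj : v ≠ j := fun h => Set.disjoint_left.1 hGH hv (h ▸ ⟨i, hij.symm⟩)
    simp [hvi, hvj]

theorem exists_add_eq_of_sup (hm : m ∈ edgePow (G ⊔ H) k) :
    ∃ a b, a + b = k ∧ m ∈ edgePow G a ∧ m ∈ edgePow H b := by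
  induction k generalizing m with
  | zero => exact ⟨0, 0, rfl, trivial, trivial⟩
  | succ k ih =>
    obtain ⟨i, j, hij, m, hm, rfl⟩ := hm
    obtain ⟨a, b, rfl, ha, hb⟩ := ih hm
    have hle : m ≤ m + Pi.single i 1 + Pi.single j 1 := add_assoc m _ _ ▸ le_self_add
    rcases hij with hij | hij
    · exact ⟨a + 1, b, by omega, add_edge ha hij, isUpperSet hle hb⟩
    · exact ⟨a, b + 1, rfl, isUpperSet hle ha, add_edge hb hij⟩

end edgePow

/-- The order of the monomial `x^m` in the `I(G)`-adic filtration: the largest `k` for which it lies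
in the `k`-th power of the edge ideal. -/
noncomputable def edgeOrder (G : SimpleGraph V) (m : V → ℕ) : ℕ :=
  sSup {k | m ∈ edgePow G k}

variable [Finite V]

theorem mem_edgePow_iff_le_edgeOrder : m ∈ edgePow G k ↔ k ≤ edgeOrder G m := by
  have := Fintype.ofFinite V
  have hbdd : BddAbove {k | m ∈ edgePow G k} :=
    ⟨∑ v, m v, fun _ => edgePow.le_sum_of_isVertexCover (by simp)⟩
  exact ⟨fun hm => le_csSup hbdd hm,
    fun hk => edgePow.antitone hk (Nat.sSup_mem (s := {k | m ∈ edgePow G k}) ⟨0, trivial⟩ hbdd)⟩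

theorem setOf_edgeOrder_eq : {m | edgeOrder G m = k} = edgePow G k \ edgePow G (k + 1) := by
  ext m
  simp only [Set.mem_ofPred_eq, Set.mem_sdiff, mem_edgePow_iff_le_edgeOrder]
  omega

theorem edgeOrder_sup (hGH : Disjoint G.support H.support) (m : V → ℕ) :
    edgeOrder (G ⊔ H) m = edgeOrder G m + edgeOrder H m := by
  apply le_antisymm
  · obtain ⟨a, b, hab, ha, hb⟩ :=
      edgePow.exists_add_eq_of_sup (mem_edgePow_iff_le_edgeOrder.2 (le_refl (edgeOrder (G ⊔ H) m)))
    exact hab ▸ add_le_add (mem_edgePow_iff_le_edgeOrder.1 ha) (mem_edgePow_iff_le_edgeOrder.1 hb)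
  · exact mem_edgePow_iff_le_edgeOrder.1 (edgePow.sup_of_disjoint hGH
      (mem_edgePow_iff_le_edgeOrder.2 le_rfl) (mem_edgePow_iff_le_edgeOrder.2 le_rfl))

theorem edgePow.stanleyPartition_zero (hA : G.support ⊆ A) : StanleyPartition A 0 (edgePow G k) :=
  (dependsOnTruncation hA).stanleyPartition

theorem edgePow.stanleyPartition_one (hA : G.support ⊆ A) (hk : 1 ≤ k) :
    StanleyPartition A 1 (edgePow G k) := by
  rcases A.eq_empty_or_nonempty with rfl | ⟨v, hv⟩
  · obtain ⟨k, rfl⟩ := Nat.exists_eq_add_of_le' hk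
    refine StanleyPartition.empty.congr fun m => iff_of_false ?_ (Set.notMem_empty m)
    rintro ⟨i, j, hij, -⟩
    exact Finset.notMem_empty i (hA ⟨j, hij⟩)
  · exact (dependsOnTruncation hA).stanleyPartition_one hv
      fun m hm c hc => isUpperSet (le_update_self_iff.2 hc) hm

theorem stanleyPartition_edgeOrder_zero (hA : G.support ⊆ A) :
    StanleyPartition A 0 {m | edgeOrder G m = k} := by
  rw [setOf_edgeOrder_eq]
  exact (((edgePow.dependsOnTruncation hA).mono subset_rfl k.le_succ).inter
    (edgePow.dependsOnTruncation hA).compl).stanleyPartition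

end EdgePow

section Koenig

variable {V : Type*} {G : SimpleGraph V} {m : V → ℕ} {k : ℕ} {C D W : Finset V}
  {x : V} {q : V → Prop}

theorem isVertexCover_uncross [DecidableEq V] [DecidablePred q]
    (hq : ∀ u v, G.Adj u v → (q u ↔ ¬ q v)) (hD : G.IsVertexCover D)
    (hW : G.IsVertexCover W) :
    G.IsVertexCover ((D ∩ W ∪ {v ∈ D ∪ W | q v} : Finset V) : Set V) := by
  intro u v huv
  have hDuv := hD huv
  have hWuv := hW huv
  have hquv := hq u v huv
  simp only [Finset.mem_coe, Finset.mem_union, Finset.mem_inter, Finset.mem_filter] at *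
  tauto

theorem sum_uncross [DecidableEq V] [DecidablePred q] :
    ∑ v ∈ D ∩ W ∪ {v ∈ D ∪ W | q v}, m v + ∑ v ∈ D ∩ W ∪ {v ∈ D ∪ W | ¬ q v}, m v =
      ∑ v ∈ D, m v + ∑ v ∈ W, m v := by
  rw [← Finset.sum_union_inter (s₁ := D), ← Finset.sum_union_inter (s₁ := D ∩ W ∪ _)]
  congr 2 <;> ext v <;>
    simp only [Finset.mem_union, Finset.mem_inter, Finset.mem_filter] <;> tauto

variable [Finite V]

/-- A vertex cover of smallest weight cannot be improved by exchanging `x` for those of its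
neighbours which are still missing, so some missing neighbour has positive weight. -/
theorem exists_adj_notMem_of_forall_le_sum
    (hmin : ∀ W : Finset V, G.IsVertexCover W → ∑ v ∈ C, m v ≤ ∑ v ∈ W, m v)
    (hC : G.IsVertexCover C) (hx : x ∈ C) (hmx : 0 < m x) : ∃ y, G.Adj x y ∧ y ∉ C ∧ 0 < m y := by
  classical
  have := Fintype.ofFinite V
  by_contra! hzero
  let S : Finset V := {y | G.Adj x y ∧ y ∉ C}
  have hS : ∑ v ∈ S, m v = 0 := Finset.sum_eq_zero fun v hv => by
    rw [Finset.mem_filter_univ] at hv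
    exact Nat.le_zero.1 (hzero v hv.1 hv.2)
  have hcover : G.IsVertexCover (C.erase x ∪ S : Finset V) := by
    intro u v huv
    have := hC huv
    simp only [S, Finset.mem_coe, Finset.mem_union, Finset.mem_erase, Finset.mem_filter_univ]
      at this ⊢
    grind [huv.symm, huv.ne]
  have hle := hmin _ hcover
  have hunion := Finset.sum_union_inter (s₁ := C.erase x) (s₂ := S) (f := m)
  have herase := Finset.add_sum_erase C m hx
  omega

/-- Take a cover of smallest weight containing `x` with as many vertices as possible opposite to
`x`. An edge from `x` leaving it works: a second cover of smallest weight containing both ends could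
be uncrossed with the first one. -/
theorem exists_adj_lt_sum (hq : ∀ u v, G.Adj u v → (q u ↔ ¬ q v))
    (hmin : ∀ W : Finset V, G.IsVertexCover W → ∑ v ∈ C, m v ≤ ∑ v ∈ W, m v)
    (hC : G.IsVertexCover C) (hx : x ∈ C) (hmx : 0 < m x) (hqx : ¬ q x) :
    ∃ y, G.Adj x y ∧ 0 < m y ∧ ∀ W : Finset V, G.IsVertexCover W → x ∈ W → y ∈ W →
      ∑ v ∈ C, m v < ∑ v ∈ W, m v := by
  classical
  have := Fintype.ofFinite V
  let optimal : Finset (Finset V) :=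
    {D | G.IsVertexCover D ∧ ∑ v ∈ D, m v = ∑ v ∈ C, m v ∧ x ∈ D}
  have hoptimal : ∀ {D}, D ∈ optimal ↔
      G.IsVertexCover D ∧ ∑ v ∈ D, m v = ∑ v ∈ C, m v ∧ x ∈ D := by simp [optimal]
  obtain ⟨D, hD, hDmax⟩ := optimal.exists_max_image (fun D => (D.filter q).card)
    ⟨C, hoptimal.2 ⟨hC, rfl, hx⟩⟩
  obtain ⟨hDcover, hDsum, hxD⟩ := hoptimal.1 hD
  obtain ⟨y, hxy, hyD, hmy⟩ :=
    exists_adj_notMem_of_forall_le_sum (hDsum ▸ hmin) hDcover hxD hmx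
  refine ⟨y, hxy, hmy, fun W hW hxW hyW => (hmin W hW).lt_of_ne fun hWsum => ?_⟩
  let M : Finset V := D ∩ W ∪ {v ∈ D ∪ W | q v}
  have hMcover : G.IsVertexCover M := isVertexCover_uncross hq hDcover hW
  have hMsum : ∑ v ∈ M, m v = ∑ v ∈ C, m v := by
    have hM := hmin M hMcover
    have hM' := hmin _ (isVertexCover_uncross (fun u v huv => not_congr (hq u v huv)) hDcover hW)
    have huncross : ∑ v ∈ M, m v + _ = _ := sum_uncross
    omega
  refine (hDmax M (hoptimal.2 ⟨hMcover, hMsum, by simp [M, hxD, hxW]⟩)).not_gt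
    (Finset.card_lt_card ((Finset.ssubset_iff_of_subset fun v hv => ?_).2 ⟨y, ?_, ?_⟩))
  · simp_all [M]
  · have := hq x y hxy
    simp_all [M]
  · simp [hyD]

variable [DecidableEq V]

/-- The hard half of the weighted form of König's theorem. -/
theorem edgePow.of_forall_le_sum (hG : G.IsBipartite)
    (h : ∀ W : Finset V, G.IsVertexCover W → k ≤ ∑ v ∈ W, m v) : m ∈ edgePow G k := by
  have := Fintype.ofFinite V
  classical
  obtain ⟨c⟩ := hG
  induction k generalizing m with
  | zero => trivial
  | succ k ih =>
    obtain ⟨C, hC, hmin⟩ := Finset.exists_min_image {W : Finset V | G.IsVertexCover W}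
      (fun W => ∑ v ∈ W, m v) ⟨Finset.univ, by simp⟩
    simp only [Finset.mem_filter_univ] at hC hmin
    have hCpos : ∑ v ∈ C, m v ≠ 0 := by
      have := h C hC
      omega
    obtain ⟨x, hx, hmx⟩ := Finset.exists_ne_zero_of_sum_ne_zero hCpos
    obtain ⟨y, hxy, hmy, hlt⟩ := exists_adj_lt_sum (q := fun v => c v ≠ c x)
      (fun u v huv => by have := c.valid huv; omega) hmin hC hx (Nat.pos_of_ne_zero hmx)
      (not_not.2 rfl)
    refine of_sub_edge hxy (Nat.one_le_iff_ne_zero.2 hmx) hmy (ih fun W hW => ?_)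
    have hsum : ∑ v ∈ W, m v ≤ ∑ v ∈ W, (m - Pi.single x 1 - Pi.single y 1 : V → ℕ) v +
        ((if x ∈ W then 1 else 0) + if y ∈ W then 1 else 0) := by
      simp only [← Finset.sum_pi_single', ← Finset.sum_add_distrib]
      refine Finset.sum_le_sum fun v _ => ?_
      simp only [Pi.sub_apply]
      omega
    have := h C hC
    have := h W hW
    by_cases hxW : x ∈ W <;> by_cases hyW : y ∈ W <;>
      simp only [hxW, hyW, if_true, if_false] at hsum
    · have := hlt W hW hxW hyW
      omega
    all_goals omega

theorem stanleyPartition_edgeOrder_one {A : Finset V} (hG : G.IsBipartite) (hA : G.support ⊆ A)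
    (hne : A.Nonempty) : StanleyPartition A 1 {m | edgeOrder G m = k} := by
  rw [setOf_edgeOrder_eq]
  refine ((edgePow.dependsOnTruncation hA).mono subset_rfl k.le_succ).stanleyPartition_diff
    (edgePow.dependsOnTruncation hA) edgePow.isUpperSet edgePow.isUpperSet fun m _ hm => ?_
  obtain ⟨v, hvA, W, hW, hvW, hWsum⟩ : ∃ v ∈ A, ∃ W : Finset V,
      G.IsVertexCover W ∧ v ∉ W ∧ ∑ w ∈ W, m w ≤ k := by
    obtain ⟨W, hW, hWsum⟩ : ∃ W : Finset V, G.IsVertexCover W ∧ ∑ w ∈ W, m w ≤ k := by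
      contrapose! hm
      exact edgePow.of_forall_le_sum hG hm
    by_cases hAW : A ⊆ W
    · obtain ⟨v, hv⟩ := hne
      refine ⟨v, hv, A.erase v, fun i j hij => ?_, by simp, le_trans
        (Finset.sum_le_sum_of_subset ((Finset.erase_subset v A).trans hAW)) hWsum⟩
      have hi : i ∈ A := hA ⟨j, hij⟩
      have hj : j ∈ A := hA ⟨i, hij.symm⟩
      have := hij.ne
      simp only [Finset.coe_erase, Set.mem_sdiff, Finset.mem_coe, Set.mem_singleton_iff]
      grind
    · obtain ⟨v, hvA, hvW⟩ := Finset.not_subset.1 hAW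
      exact ⟨v, hvA, W, hW, hvW, hWsum⟩
  refine ⟨v, hvA, fun c hc => ?_⟩
  have := edgePow.le_sum_of_isVertexCover hW hc
  rw [Finset.sum_update_of_notMem hvW] at this
  omega

end Koenig

section Forest

theorem isAcyclic_map {V W : Type*} {G : SimpleGraph V} (f : V ↪ W) (hG : G.IsAcyclic) :
    (G.map f).IsAcyclic := by
  rw [SimpleGraph.isAcyclic_iff_free_cycleGraph] at hG ⊢
  rintro (_ | _ | n) hn ⟨⟨c, hc⟩⟩
  · omega
  · omega
  have hrange : ∀ i, ∃ v, f v = c i := by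
    intro i
    have hi : (SimpleGraph.cycleGraph (n + 2)).Adj i (i + 1) := by
      simp [SimpleGraph.cycleGraph_adj]
    obtain ⟨-, v, -, -, hv, -⟩ := c.map_rel hi
    exact ⟨v, hv⟩
  choose g hg using hrange
  refine hG _ hn ⟨⟨⟨g, fun {i j} hij => ?_⟩, fun i j hij => hc ?_⟩⟩
  · have h := c.map_rel hij
    rwa [← hg, ← hg, SimpleGraph.map_adj_apply] at h
  · exact (hg i).symm.trans ((congrArg f hij).trans (hg j))

variable {V : Type*} {G : SimpleGraph V}

theorem exists_leaf_of_isAcyclic [Finite V] (hG : G.IsAcyclic) (hne : G ≠ ⊥) :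
    ∃ x y, G.Adj x y ∧ ∀ z, G.Adj x z → z = y := by
  classical
  obtain ⟨i, j, hij⟩ := SimpleGraph.ne_bot_iff_exists_adj.1 hne
  let C := G.connectedComponentMk i
  have hjC : j ∈ C := (SimpleGraph.ConnectedComponent.connectedComponentMk_eq_of_adj hij).symm
  have : Nontrivial C := ⟨⟨i, rfl⟩, ⟨j, hjC⟩, fun h => hij.ne (congrArg Subtype.val h)⟩
  have : Fintype C := Fintype.ofFinite C
  obtain ⟨x, hx⟩ := (hG.isTree_connectedComponent C).exists_vert_degree_one_of_nontrivial
  obtain ⟨y, hxy, hy⟩ := SimpleGraph.degree_eq_one_iff_existsUnique_adj.1 hx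
  refine ⟨x, y, hxy, fun z hxz => ?_⟩
  exact congrArg Subtype.val (hy ⟨z, C.mem_supp_of_adj_mem_supp x.2 hxz⟩ hxz)

variable [DecidableEq V] {A : Finset V} {k : ℕ} {m : V → ℕ} {x y : V}

theorem edgePow_succ_eq_of_leaf (hxy : G.Adj x y) (hleaf : ∀ z, G.Adj x z → z = y) :
    edgePow G (k + 1) = {m | m x = 0} ∩ edgePow (G.deleteIncidenceSet x) (k + 1) ∪
      {m | m y = 0} ∩ ({m | 1 ≤ m x} ∩ edgePow (G.deleteIncidenceSet y) (k + 1)) ∪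
      (· + (Pi.single x 1 + Pi.single y 1)) '' edgePow G k := by
  ext m
  simp only [Set.mem_union, Set.mem_inter_iff, Set.mem_ofPred_eq, Set.mem_image, ← add_assoc]
  constructor
  · intro hm
    rcases Nat.eq_zero_or_pos (m x) with hx | hx
    · exact .inl (.inl ⟨hx, (edgePow.mem_deleteIncidenceSet_of_eq_zero hx).2 hm⟩)
    rcases Nat.eq_zero_or_pos (m y) with hy | hy
    · exact .inl (.inr ⟨hy, hx, (edgePow.mem_deleteIncidenceSet_of_eq_zero hy).2 hm⟩)
    have hsub : m - Pi.single x 1 - Pi.single y 1 + Pi.single x 1 + Pi.single y 1 = m := by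
      have := hxy.ne
      funext v
      simp only [Pi.add_apply, Pi.sub_apply, Pi.single_apply]
      grind
    exact .inr ⟨_, (edgePow.add_edge_iff_of_leaf hxy hleaf).1 (hsub.symm ▸ hm), hsub⟩
  · rintro ((⟨-, hm⟩ | ⟨-, -, hm⟩) | ⟨n, hn, rfl⟩)
    · exact edgePow.mono_graph (G.deleteIncidenceSet_le x) hm
    · exact edgePow.mono_graph (G.deleteIncidenceSet_le y) hm
    · exact edgePow.add_edge hn hxy

theorem support_deleteIncidenceSet_subset_erase (hA : G.support ⊆ A) (x : V) :
    (G.deleteIncidenceSet x).support ⊆ A.erase x := by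
  rw [Finset.coe_erase]
  exact (G.support_deleteIncidenceSet_subset x).trans (Set.sdiff_subset_sdiff_left hA)

variable [Finite V]

theorem edgePow.stanleyPartition_two_succ_of_leaf (hA : G.support ⊆ A) (hxy : G.Adj x y)
    (hleaf : ∀ z, G.Adj x z → z = y)
    (hdelete : StanleyPartition (A.erase x) 2 (edgePow (G.deleteIncidenceSet x) (k + 1)))
    (hk : StanleyPartition A 2 (edgePow G k)) : StanleyPartition A 2 (edgePow G (k + 1)) := by
  have hx : x ∈ A := hA ⟨y, hxy⟩
  have hy : y ∈ A := hA ⟨x, hxy.symm⟩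
  have hsupport : (G.deleteIncidenceSet y).support ⊆ (A.erase y).erase x := by
    intro v hv
    have hvy := support_deleteIncidenceSet_subset_erase hA y hv
    obtain ⟨w, hvw⟩ := hv
    obtain ⟨hvw, -, hwy⟩ := SimpleGraph.deleteIncidenceSet_adj.1 hvw
    refine Finset.mem_coe.2 (Finset.mem_erase.2 ⟨?_, hvy⟩)
    rintro rfl
    exact hwy (hleaf w hvw)
  have h₁ := (StanleyPartition.setOf_eq x 0).inter_erase hx hdelete
  have h₂ := (StanleyPartition.setOf_eq y 0).inter_erase hy
    ((StanleyPartition.setOf_ge x 1).inter_erase (Finset.mem_erase.2 ⟨hxy.ne, hx⟩)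
      (edgePow.stanleyPartition_one hsupport k.succ_pos))
  have h₃ := hk.image_add_right (a := Pi.single x 1 + Pi.single y 1) fun v hv => by
    simp [ne_of_mem_of_not_mem hx hv, ne_of_mem_of_not_mem hy hv, Ne.symm]
  rw [edgePow_succ_eq_of_leaf hxy hleaf]
  refine (h₁.union h₂ ?_).union h₃ ?_
  · exact Set.disjoint_left.2 fun m hm hm' => by
      have := hm.1
      have := hm'.2.1
      simp_all
  · rw [Set.disjoint_left]
    rintro _ (⟨hm, -⟩ | ⟨hm, -⟩) ⟨n, -, rfl⟩ <;> simp at hm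

theorem edgePow.stanleyPartition_two (hG : G.IsAcyclic) (hA : G.support ⊆ A) (hk : 1 ≤ k) :
    StanleyPartition A 2 (edgePow G k) := by
  obtain ⟨k, rfl⟩ := Nat.exists_eq_add_of_le' hk
  induction A using Finset.strongInduction generalizing G k with
  | H A ihA =>
    rcases eq_or_ne G ⊥ with rfl | hne
    · refine StanleyPartition.empty.congr fun m => iff_of_false ?_ (Set.notMem_empty m)
      rintro ⟨i, j, hij, -⟩
      exact hij
    obtain ⟨x, y, hxy, hleaf⟩ := exists_leaf_of_isAcyclic hG hne
    have hx : x ∈ A := hA ⟨y, hxy⟩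
    have hy : y ∈ A := hA ⟨x, hxy.symm⟩
    have hdelete : ∀ l, StanleyPartition (A.erase x) 2
        (edgePow (G.deleteIncidenceSet x) (l + 1)) := fun l =>
      ihA _ (Finset.erase_ssubset hx) (hG.anti (G.deleteIncidenceSet_le x))
        (support_deleteIncidenceSet_subset_erase hA x) l l.succ_pos
    induction k with
    | zero =>
      exact stanleyPartition_two_succ_of_leaf hA hxy hleaf (hdelete 0)
        ((StanleyPartition.univ A).mono (Finset.one_lt_card.2 ⟨x, hx, y, hy, hxy.ne⟩))
    | succ k ih =>
      exact stanleyPartition_two_succ_of_leaf hA hxy hleaf (hdelete _) (ih k.succ_pos)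

end Forest

section DisjointUnion

open scoped Function

variable {V : Type*}

section Sup

variable {G H : SimpleGraph V} {A B : Finset V} {d e k : ℕ}

theorem disjoint_support_of_subset (hAB : Disjoint A B) (hG : G.support ⊆ A) (hH : H.support ⊆ B) :
    Disjoint G.support H.support :=
  (Finset.disjoint_coe.2 hAB).mono hG hH

variable [DecidableEq V] [Finite V]

theorem stanleyPartition_edgeOrder_sup (hAB : Disjoint A B) (hG : G.support ⊆ A)
    (hH : H.support ⊆ B) (hGlayer : ∀ i, StanleyPartition A d {m | edgeOrder G m = i})
    (hHlayer : ∀ i, StanleyPartition B e {m | edgeOrder H m = i}) :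
    StanleyPartition (A ∪ B) (d + e) {m | edgeOrder (G ⊔ H) m = k} := by
  have hsup := edgeOrder_sup (disjoint_support_of_subset hAB hG hH)
  refine .of_fibers (edgeOrder G) ((Set.finite_Iic k).subset ?_) fun m hm => ?_
  · rintro _ ⟨m, rfl, rfl⟩
    simp [hsup]
  · refine ((hGlayer (edgeOrder G m)).inter (hHlayer (edgeOrder H m)) hAB).congr fun n => ?_
    simp only [Set.mem_ofPred_eq, Set.mem_inter_iff, hsup] at hm ⊢
    omega

theorem edgePow.stanleyPartition_sup (hAB : Disjoint A B) (hG : G.support ⊆ A)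
    (hH : H.support ⊆ B) (hGlayer : ∀ i, StanleyPartition A d {m | edgeOrder G m = i})
    (hGpow : StanleyPartition A d (edgePow G k))
    (hHpow : ∀ i, 1 ≤ i → StanleyPartition B e (edgePow H i)) (he : e ≤ B.card) :
    StanleyPartition (A ∪ B) (d + e) (edgePow (G ⊔ H) k) := by
  have hsup := edgeOrder_sup (disjoint_support_of_subset hAB hG hH)
  refine .of_fibers (fun m => min (edgeOrder G m) k) ((Set.finite_Iic k).subset ?_) fun m _ => ?_
  · rintro _ ⟨m, -, rfl⟩
    exact Set.mem_Iic.2 (min_le_right _ _)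
  rcases lt_or_ge (edgeOrder G m) k with hm | hm
  · refine ((hGlayer (edgeOrder G m)).inter (hHpow (k - edgeOrder G m) (by omega)) hAB).congr
      fun n => ?_
    simp only [Set.mem_ofPred_eq, Set.mem_inter_iff, mem_edgePow_iff_le_edgeOrder, hsup]
    omega
  · refine (hGpow.inter ((StanleyPartition.univ B).mono he) hAB).congr fun n => ?_
    simp only [Set.mem_ofPred_eq, Set.mem_inter_iff, Set.mem_univ, and_true,
      mem_edgePow_iff_le_edgeOrder, hsup]
    omega

end Sup

section FinsetSup

variable [DecidableEq V] {ι : Type*} {H : ι → SimpleGraph V} {A : ι → Finset V}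

theorem support_finsetSup_subset (hA : ∀ i, (H i).support ⊆ A i) (S : Finset ι) :
    (S.sup H).support ⊆ S.biUnion A := by
  intro v
  rintro ⟨w, hvw⟩
  rw [Finset.sup_eq_iSup] at hvw
  simp only [SimpleGraph.iSup_adj] at hvw
  obtain ⟨i, hi, hvw⟩ := hvw
  exact Finset.mem_coe.2 (Finset.mem_biUnion.2 ⟨i, hi, hA i ⟨w, hvw⟩⟩)

theorem disjoint_biUnion_of_notMem (hA : Pairwise (Disjoint on A)) {S : Finset ι} {i : ι}
    (hi : i ∉ S) : Disjoint (S.biUnion A) (A i) :=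
  (Finset.disjoint_biUnion_left _ _ _).2 fun _ hj => hA (ne_of_mem_of_not_mem hj hi)

open Classical in
theorem stanleyPartition_finsetSup [Finite V] (hA : ∀ i, (H i).support ⊆ A i)
    (hne : ∀ i, (A i).Nonempty) (hdisjoint : Pairwise (Disjoint on A)) (S : Finset ι) :
    (∀ k, StanleyPartition (S.biUnion A) (S.filter fun i => (H i).IsBipartite).card
      {m | edgeOrder (S.sup H) m = k}) ∧
    ∀ k, StanleyPartition (S.biUnion A) (S.filter fun i => (H i).IsBipartite).card
      (edgePow (S.sup H) k) := by
  induction S using Finset.induction_on with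
  | empty =>
    have hsupport := support_finsetSup_subset hA ∅
    exact ⟨fun _ => stanleyPartition_edgeOrder_zero hsupport,
      fun _ => edgePow.stanleyPartition_zero hsupport⟩
  | insert i S hi ih =>
    have hS := support_finsetSup_subset hA S
    have hSi := disjoint_biUnion_of_notMem hdisjoint hi
    rw [Finset.biUnion_insert, Finset.union_comm, Finset.sup_insert, sup_comm,
      Finset.filter_insert]
    split_ifs with hbip
    · rw [Finset.card_insert_of_notMem (by simp [hi])]
      exact ⟨fun k => stanleyPartition_edgeOrder_sup hSi hS (hA i) ih.1
          fun _ => stanleyPartition_edgeOrder_one hbip (hA i) (hne i),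
        fun k => edgePow.stanleyPartition_sup hSi hS (hA i) ih.1 (ih.2 k)
          (fun _ hl => edgePow.stanleyPartition_one (hA i) hl) (hne i).card_pos⟩
    · exact ⟨fun k => stanleyPartition_edgeOrder_sup (e := 0) hSi hS (hA i) ih.1
          fun _ => stanleyPartition_edgeOrder_zero (hA i),
        fun k => edgePow.stanleyPartition_sup (e := 0) hSi hS (hA i) ih.1 (ih.2 k)
          (fun _ _ => edgePow.stanleyPartition_zero (hA i)) (Nat.zero_le _)⟩

end FinsetSup

section Components

variable (G : SimpleGraph V) [Fintype G.ConnectedComponent]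

theorem sup_spanningCoe_components :
    Finset.univ.sup (fun C : G.ConnectedComponent => C.toSimpleGraph.spanningCoe) = G := by
  ext v w
  simp only [Finset.sup_univ_eq_iSup, SimpleGraph.iSup_adj,
    SimpleGraph.ConnectedComponent.adj_spanningCoe_toSimpleGraph, exists_and_right]
  exact and_iff_right ⟨_, SimpleGraph.ConnectedComponent.connectedComponentMk_mem⟩

open Classical in
theorem numBipartiteComponents_le (C : G.ConnectedComponent) :
    numBipartiteComponents G ≤ ((Finset.univ.erase C).filter fun D : G.ConnectedComponent =>
      D.toSimpleGraph.spanningCoe.IsBipartite).card + 1 := by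
  have hcard : numBipartiteComponents G =
      (Finset.univ.filter fun D : G.ConnectedComponent => D.toSimpleGraph.IsBipartite).card := by
    rw [numBipartiteComponents, Nat.card_eq_fintype_card, Fintype.card_subtype]
  rw [hcard]
  refine (Finset.card_le_card fun D hD => ?_).trans (Finset.card_insert_le C _)
  rw [Finset.mem_filter_univ] at hD
  have hbip : D.toSimpleGraph.spanningCoe.IsBipartite := SimpleGraph.Colorable.map _ hD
  by_cases h : D = C <;> simp [h, hbip]

theorem edgePow.stanleyPartition_univ [DecidableEq V] [Fintype V] {G : SimpleGraph V}
    {C : G.ConnectedComponent} (hC : C.toSimpleGraph.IsAcyclic) (hne : C.toSimpleGraph ≠ ⊥)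
    (k : ℕ) :
    StanleyPartition Finset.univ (numBipartiteComponents G + 1) (edgePow G k) := by
  classical
  let H : G.ConnectedComponent → SimpleGraph V := fun D => D.toSimpleGraph.spanningCoe
  let A : G.ConnectedComponent → Finset V := fun D => D.supp.toFinset
  let S : Finset G.ConnectedComponent := Finset.univ.erase C
  have hA : ∀ D, (H D).support ⊆ A D := fun D => by
    rw [SimpleGraph.support_spanningCoe, Set.coe_toFinset]
    exact Subtype.coe_image_subset _ _
  have hdisjoint : Pairwise (Disjoint on A) := fun D E hDE =>
    Set.disjoint_toFinset.2 (G.pairwise_disjoint_supp_connectedComponent hDE)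
  have hcard : 2 ≤ (A C).card := by
    obtain ⟨u, v, huv⟩ := SimpleGraph.ne_bot_iff_exists_adj.1 hne
    exact Finset.one_lt_card.2 ⟨u, by simp [A], v, by simp [A], huv.ne ∘ Subtype.ext⟩
  have hrest := stanleyPartition_finsetSup hA
    (fun D => Set.toFinset_nonempty.2 D.nonempty_supp) hdisjoint S
  have hsup : S.sup H ⊔ H C = G := by
    rw [sup_comm, ← Finset.sup_insert, Finset.insert_erase (Finset.mem_univ C)]
    exact sup_spanningCoe_components G
  have hunion : S.biUnion A ∪ A C = Finset.univ := by
    rw [Finset.union_comm, ← Finset.biUnion_insert, Finset.insert_erase (Finset.mem_univ C)]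
    ext v
    simp [A]
  have h := edgePow.stanleyPartition_sup (disjoint_biUnion_of_notMem hdisjoint
    (Finset.notMem_erase C _)) (support_finsetSup_subset hA S) (hA C) hrest.1 (hrest.2 k)
    (fun i hi => edgePow.stanleyPartition_two (isAcyclic_map _ hC) (hA C) hi) hcard
  rw [hsup, hunion] at h
  exact h.mono (Nat.succ_le_succ (numBipartiteComponents_le G C))

end Components

end DisjointUnion

section Algebra

open MvPolynomial

variable {V : Type*}

theorem StanleyPartition.exists_family [DecidableEq V] {A : Finset V} {d : ℕ} {U : Set (V → ℕ)}
    (h : StanleyPartition A d U) : ∃ (ι : Type) (_ : Finite ι) (a : ι → V → ℕ) (Z : ι → Finset V),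
      (∀ i, d ≤ (Z i).card) ∧ (Pairwise fun i j => Disjoint (stanleyCone (a i) (Z i))
        (stanleyCone (a j) (Z j))) ∧ U = ⋃ i, stanleyCone (a i) (Z i) := by
  induction h with
  | empty =>
    exact ⟨Empty, inferInstance, Empty.elim, Empty.elim, by simp, fun i => i.elim, by simp⟩
  | cone a Z _ _ hd =>
    exact ⟨Unit, inferInstance, fun _ => a, fun _ => Z,
      fun _ => hd.trans (Finset.card_le_card Finset.inter_subset_left),
      fun i j h => absurd rfl h, (Set.iUnion_const _).symm⟩
  | union _ _ hUW ih₁ ih₂ =>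
    obtain ⟨ι₁, _, a₁, Z₁, hd₁, hp₁, rfl⟩ := ih₁
    obtain ⟨ι₂, _, a₂, Z₂, hd₂, hp₂, rfl⟩ := ih₂
    simp only [Set.disjoint_iUnion_left, Set.disjoint_iUnion_right] at hUW
    refine ⟨ι₁ ⊕ ι₂, inferInstance, Sum.elim a₁ a₂, Sum.elim Z₁ Z₂, ?_, ?_, ?_⟩
    · rintro (i | i)
      exacts [hd₁ i, hd₂ i]
    · rintro (i | i) (j | j) hij
      · exact hp₁ fun h => hij (h ▸ rfl)
      · exact hUW j i
      · exact (hUW i j).symm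
      · exact hp₂ fun h => hij (h ▸ rfl)
    · simp only [Set.iUnion_sum, Sum.elim_inl, Sum.elim_inr]

section RestrictSupport

variable {R ι : Type*} [CommSemiring R]

theorem toSubmodule_supported (Z : Set V) :
    (supported R Z).toSubmodule = restrictSupport R {m : V →₀ ℕ | ∀ v ∉ Z, m v = 0} := by
  ext f
  simp only [Subalgebra.mem_toSubmodule, mem_supported, mem_restrictSupport_iff, Set.subset_def,
    Finset.mem_coe, mem_vars_iff_mem_support, Set.mem_ofPred_eq, Finsupp.mem_support_iff]
  grind

theorem iSupIndep_restrictSupport {s : ι → Set (V →₀ ℕ)}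
    (hs : Pairwise fun i j => Disjoint (s i) (s j)) :
    iSupIndep fun i => restrictSupport R (s i) := by
  intro i
  refine Disjoint.mono_right (c := restrictSupport R (s i)ᶜ)
    (iSup₂_le fun j hj => restrictSupport_mono R (hs hj).subset_compl_right) ?_
  rw [Submodule.disjoint_def]
  intro f hf hfc
  rw [mem_restrictSupport_iff] at hf hfc
  rw [← support_eq_empty, Finset.eq_empty_iff_forall_notMem]
  exact fun m hm => hfc hm (hf hm)

theorem iSup_restrictSupport (s : ι → Set (V →₀ ℕ)) :
    ⨆ i, restrictSupport R (s i) = restrictSupport R (⋃ i, s i) := by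
  simp only [restrictSupport_eq_span, Set.image_iUnion, Submodule.span_iUnion]

end RestrictSupport

variable {K : Type*} [Field K]

theorem stanleySpace_monomial (a : V →₀ ℕ) (Z : Finset V) :
    stanleySpace (monomial a (1 : K)) Z = restrictSupport K ((⇑) ⁻¹' stanleyCone a Z) := by
  rw [stanleySpace, toSubmodule_supported, restrictSupport_eq_span, restrictSupport_eq_span,
    Submodule.map_span]
  congr 1
  ext f
  simp only [Set.mem_image, exists_exists_and_eq_and, LinearMap.mulLeft_apply, monomial_mul,
    mul_one]
  constructor
  · rintro ⟨m, hm, rfl⟩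
    exact ⟨a + m, fun v => ⟨by simp, fun hv => by simp [hm v hv]⟩, rfl⟩
  · rintro ⟨m, hm, rfl⟩
    refine ⟨m - a, fun v hv => by simp [(hm v).2 hv], ?_⟩
    rw [add_tsub_cancel_of_le fun v => (hm v).1]

theorem le_sdepth_of_family {J : Ideal (MvPolynomial V K)} {ι : Type*} [Finite ι] {d : ℕ}
    (a : ι → V →₀ ℕ) {Z : ι → Finset V} (hd : ∀ i, d ≤ (Z i).card)
    (hdisjoint : Pairwise fun i j =>
      Disjoint (stanleyCone (a i) (Z i)) (stanleyCone (a j) (Z j)))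
    (hJ : ∀ f, f ∈ J ↔ ∀ m ∈ f.support, ⇑m ∈ ⋃ i, stanleyCone (a i) (Z i)) :
    (d : ℕ∞) ≤ sdepth J := by
  let σ := Finite.equivFin ι
  have hindep : iSupIndep fun i => stanleySpace (monomial (a i) (1 : K)) (Z i) := by
    simp only [stanleySpace_monomial]
    exact iSupIndep_restrictSupport fun i j hij => (hdisjoint hij).preimage _
  have hsup : ⨆ i, stanleySpace (monomial (a i) (1 : K)) (Z i) = J.restrictScalars K := by
    simp only [stanleySpace_monomial]
    rw [iSup_restrictSupport, ← Set.preimage_iUnion]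
    ext f
    exact (hJ f).symm
  let D : StanleyDecomposition J :=
    { r := Nat.card ι
      u := fun i => monomial (a (σ.symm i)) 1
      Z := fun i => Z (σ.symm i)
      homogeneous := fun i => ⟨_, _, rfl⟩
      free := fun i v _ hv => (mul_eq_zero.1 hv).resolve_left (mt monomial_eq_zero.1 one_ne_zero)
      independent := hindep.comp σ.symm.injective
      iSup_eq := (σ.symm.iSup_comp
        (g := fun i => stanleySpace (monomial (a i) (1 : K)) (Z i))).trans hsup }
  exact le_iSup_of_le D (le_iInf fun i => by exact_mod_cast hd _)

variable [Finite V] [DecidableEq V]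

theorem le_sdepth_of_stanleyPartition {J : Ideal (MvPolynomial V K)} {A : Finset V} {d : ℕ}
    {U : Set (V → ℕ)} (hU : StanleyPartition A d U)
    (hJ : ∀ f, f ∈ J ↔ ∀ m ∈ f.support, ⇑m ∈ U) : (d : ℕ∞) ≤ sdepth J := by
  obtain ⟨ι, _, a, Z, hd, hdisjoint, rfl⟩ := hU.exists_family
  exact le_sdepth_of_family (fun i => Finsupp.equivFunOnFinite.symm (a i)) hd hdisjoint hJ

theorem edgeIdeal_pow_eq_span (G : SimpleGraph V) (k : ℕ) :
    edgeIdeal K G ^ k =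
      Ideal.span ((fun m => monomial m (1 : K)) '' {m : V →₀ ℕ | ⇑m ∈ edgePow G k}) := by
  induction k with
  | zero =>
    rw [pow_zero, Ideal.one_eq_top, eq_comm, Ideal.eq_top_iff_one]
    exact Ideal.subset_span ⟨0, trivial, rfl⟩
  | succ k ih =>
    rw [pow_succ, ih, edgeIdeal, Ideal.span_mul_span']
    congr 1
    ext f
    simp only [Set.mem_mul, Set.mem_image, Set.mem_ofPred_eq, exists_exists_and_eq_and]
    constructor
    · rintro ⟨m, hm, _, ⟨i, j, hij, rfl⟩, rfl⟩
      refine ⟨m + Finsupp.single i 1 + Finsupp.single j 1, ?_, ?_⟩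
      · simp only [Finsupp.coe_add, Finsupp.single_eq_pi_single]
        exact edgePow.add_edge hm hij
      · simp [X, monomial_mul, add_assoc]
    · rintro ⟨m, ⟨i, j, hij, n, hn, hm⟩, rfl⟩
      obtain ⟨n, rfl⟩ : ∃ n' : V →₀ ℕ, ⇑n' = n := ⟨Finsupp.equivFunOnFinite.symm n, rfl⟩
      refine ⟨n, hn, _, ⟨i, j, hij, rfl⟩, ?_⟩
      have hmn : m = n + Finsupp.single i 1 + Finsupp.single j 1 :=
        DFunLike.coe_injective (by
          simpa only [Finsupp.coe_add, Finsupp.single_eq_pi_single] using hm)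
      simp [hmn, X, monomial_mul, add_assoc]

theorem mem_edgeIdeal_pow (G : SimpleGraph V) (k : ℕ) (f : MvPolynomial V K) :
    f ∈ edgeIdeal K G ^ k ↔ ∀ m ∈ f.support, ⇑m ∈ edgePow G k := by
  rw [edgeIdeal_pow_eq_span, mem_ideal_span_monomial_image]
  exact forall₂_congr fun m _ =>
    ⟨fun ⟨_, hn, hnm⟩ => edgePow.isUpperSet hnm hn, fun h => ⟨m, h, le_rfl⟩⟩

end Algebra

theorem corollary3p5 (K : Type*) [Field K] {V : Type*} [Finite V] (G : SimpleGraph V)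
    (hG : ∃ H : G.ConnectedComponent, H.toSimpleGraph.IsTree ∧ H.toSimpleGraph.edgeSet.Nonempty)
    (k : ℕ) (hk : 1 ≤ k) :
    ((numBipartiteComponents G + 1 : ℕ) : ℕ∞) ≤ sdepth (edgeIdeal K G ^ k) := by
  classical
  have := Fintype.ofFinite V
  obtain ⟨C, hC, hedge⟩ := hG
  exact le_sdepth_of_stanleyPartition
    (edgePow.stanleyPartition_univ hC.isAcyclic (SimpleGraph.edgeSet_nonempty.1 hedge) k)
    (mem_edgeIdeal_pow G k)
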